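/- Let $\Gamma$ be a group (under composition) of orientation-preserving $C^1$ diffeomorphisms of the circle. Suppose that the derivatives of the elements of $\Gamma$ are uniformly bounded: there is a constant $C$ such that $|Df(\theta)| \le C$ for every $f \in \Gamma$ and every point $\theta$ of the circle. Then there exists an orientation-preserving $C^1$ diffeomorphism $\varphi$ of the circle such that $\varphi \circ f \circ \varphi^{-1}$ is a rotation for every $f \in \Gamma$; that is, $\varphi\Gamma\varphi^{-1}$ is a group of rotations. -/

import Mathlib

/-- A lift to `ℝ` of a self-map `f` of the circle `ℝ/ℤ`: a continuous `F : ℝ → ℝ` with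
`F x mod 1 = f (x mod 1)` for all `x`. Two lifts of the same map differ by an integer constant. -/
structure IsCircleLift (F : ℝ → ℝ) (f : UnitAddCircle → UnitAddCircle) : Prop where
  continuous : Continuous F
  coe_apply : ∀ x : ℝ, ((F x : ℝ) : UnitAddCircle) = f (x : UnitAddCircle)

/-- A self-map of the circle is of class `C^1` if it has a lift of class `C^1`. -/
def IsCircleC1 (f : UnitAddCircle → UnitAddCircle) : Prop :=
  ∃ F : ℝ → ℝ, IsCircleLift F f ∧ ContDiff ℝ 1 F

/-- A circle homeomorphism preserves orientation if it has a strictly increasing lift. -/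
def CircleOrientationPreserving (f : UnitAddCircle → UnitAddCircle) : Prop :=
  ∃ F : ℝ → ℝ, IsCircleLift F f ∧ StrictMono F

/-- An orientation-preserving `C^1` circle diffeomorphism: a bijection of the circle that is of
class `C^1` together with its inverse and preserves orientation. -/
structure IsCircleC1Diffeo (f : Equiv.Perm UnitAddCircle) : Prop where
  c1 : IsCircleC1 f
  c1_symm : IsCircleC1 f.symm
  orientationPreserving : CircleOrientationPreserving f

/-- The derivative of `f`, that is, the derivative of (any of) its lifts, is everywhere at most `C`
in absolute value. -/
def CircleDerivBoundedBy (f : UnitAddCircle → UnitAddCircle) (C : ℝ) : Prop :=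
  ∀ F : ℝ → ℝ, IsCircleLift F f → ∀ x : ℝ, |deriv F x| ≤ C

/-- The group of all rotations `x ↦ x + α` of the circle. -/
def circleRotations : Subgroup (Equiv.Perm UnitAddCircle) where
  carrier := {f | ∃ α : UnitAddCircle, ∀ x, f x = x + α}
  one_mem' := ⟨0, fun x => by simp⟩
  mul_mem' := by
    rintro f g ⟨α, hα⟩ ⟨β, hβ⟩
    exact ⟨β + α, fun x => by rw [Equiv.Perm.mul_apply, hα, hβ, add_assoc]⟩
  inv_mem' := by
    rintro f ⟨α, hα⟩
    refine ⟨-α, fun x => ?_⟩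
    rw [Equiv.Perm.inv_eq_iff_eq, hα]
    abel

/-! Lift everything to `ℝ` and let μ be the supremum of the derivatives of all lifts. The chain rule
gives μ(G x) · G'(x) = μ(x) for every lift G (`supDeriv_comp_mul_deriv`), so the measure μ dx is
invariant and its primitive conjugates the lifts to translations (`primitive_map`). As 1 ≤ μ ≤ C,
only the continuity of μ is missing for the primitive to be a `C^1` diffeomorphism. The translations
obtained form a subgroup of `ℝ`, dense or cyclic. If it is dense, so are the orbits; μ is lower
semicontinuous, hence oscillates little on some open set, and the invariance carries this to every
point. If it is cyclic, there are finitely many lifts up to integers, and μ is a finite maximum of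
continuous functions. -/

open Set Filter Topology MeasureTheory

/-- A group of increasing `C^1` diffeomorphisms of `ℝ` which contains the unit translation, commutes
with it, and has derivatives bounded above by `C`. -/
structure IsBoundedLiftGroup (S : Set (ℝ → ℝ)) (C : ℝ) : Prop where
  contDiff : ∀ F ∈ S, ContDiff ℝ 1 F
  strictMono : ∀ F ∈ S, StrictMono F
  comp_mem : ∀ F ∈ S, ∀ G ∈ S, F ∘ G ∈ S
  exists_inverse : ∀ F ∈ S, ∃ G ∈ S, (∀ x, G (F x) = x) ∧ ∀ x, F (G x) = x
  add_one_mem : (fun x => x + 1) ∈ S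
  map_add_one : ∀ F ∈ S, ∀ x, F (x + 1) = F x + 1
  deriv_le : ∀ F ∈ S, ∀ x, deriv F x ≤ C

/-- The pointwise supremum of the derivatives of the maps in `S`. -/
noncomputable def supDeriv (S : Set (ℝ → ℝ)) (x : ℝ) : ℝ := ⨆ F : S, deriv (F : ℝ → ℝ) x

/-- The primitive of `supDeriv S`, which conjugates `S` to translations. -/
noncomputable def supDerivPrimitive (S : Set (ℝ → ℝ)) (x : ℝ) : ℝ :=
  ∫ t in (0 : ℝ)..x, supDeriv S t

namespace IsBoundedLiftGroup

variable {S : Set (ℝ → ℝ)} {C : ℝ}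

/-! ### The invariant density -/

theorem id_mem (h : IsBoundedLiftGroup S C) : id ∈ S := by
  obtain ⟨G, hG, h1, -⟩ := h.exists_inverse _ h.add_one_mem
  have h2 := h.comp_mem _ hG _ h.add_one_mem
  have : G ∘ (fun x => x + 1) = id := funext h1
  rwa [this] at h2

theorem hasDerivAt (h : IsBoundedLiftGroup S C) {F : ℝ → ℝ} (hF : F ∈ S) (x : ℝ) :
    HasDerivAt F (deriv F x) x :=
  ((h.contDiff F hF).differentiable one_ne_zero x).hasDerivAt

theorem continuous_deriv (h : IsBoundedLiftGroup S C) {F : ℝ → ℝ} (hF : F ∈ S) :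
    Continuous (deriv F) :=
  (h.contDiff F hF).continuous_deriv le_rfl

theorem deriv_comp (h : IsBoundedLiftGroup S C) {F G : ℝ → ℝ} (hF : F ∈ S) (hG : G ∈ S) (x : ℝ) :
    deriv (F ∘ G) x = deriv F (G x) * deriv G x :=
  ((h.hasDerivAt hF (G x)).comp x (h.hasDerivAt hG x)).deriv

theorem deriv_pos (h : IsBoundedLiftGroup S C) {F : ℝ → ℝ} (hF : F ∈ S) (x : ℝ) :
    0 < deriv F x := by
  obtain ⟨G, hG, h1, -⟩ := h.exists_inverse F hF
  have h2 := h.deriv_comp hG hF x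
  rw [show G ∘ F = id from funext h1, deriv_id] at h2
  refine lt_of_le_of_ne (h.strictMono F hF).monotone.deriv_nonneg fun h0 => ?_
  rw [← h0, mul_zero] at h2
  exact one_ne_zero h2

theorem bddAbove_deriv (h : IsBoundedLiftGroup S C) (x : ℝ) :
    BddAbove (range fun F : S => deriv (F : ℝ → ℝ) x) := by
  refine ⟨C, ?_⟩
  rintro _ ⟨F, rfl⟩
  exact h.deriv_le F F.2 x

theorem deriv_le_supDeriv (h : IsBoundedLiftGroup S C) {F : ℝ → ℝ} (hF : F ∈ S) (x : ℝ) :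
    deriv F x ≤ supDeriv S x :=
  le_ciSup (h.bddAbove_deriv x) (⟨F, hF⟩ : S)

theorem supDeriv_le (h : IsBoundedLiftGroup S C) {x c : ℝ} (hc : ∀ F ∈ S, deriv F x ≤ c) :
    supDeriv S x ≤ c := by
  have : Nonempty S := ⟨⟨id, h.id_mem⟩⟩
  exact ciSup_le fun F => hc F F.2

theorem one_le_supDeriv (h : IsBoundedLiftGroup S C) (x : ℝ) : 1 ≤ supDeriv S x := by
  simpa using h.deriv_le_supDeriv h.id_mem x

theorem supDeriv_le_bound (h : IsBoundedLiftGroup S C) (x : ℝ) : supDeriv S x ≤ C :=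
  h.supDeriv_le fun F hF => h.deriv_le F hF x

/-- Chain rule, together with the fact that F ↦ F ∘ G permutes `S`. -/
theorem supDeriv_comp_mul_deriv (h : IsBoundedLiftGroup S C) {G : ℝ → ℝ} (hG : G ∈ S) (x : ℝ) :
    supDeriv S (G x) * deriv G x = supDeriv S x := by
  apply le_antisymm
  · rw [← le_div_iff₀ (h.deriv_pos hG x)]
    refine h.supDeriv_le fun F hF => ?_
    rw [le_div_iff₀ (h.deriv_pos hG x), ← h.deriv_comp hF hG]
    exact h.deriv_le_supDeriv (h.comp_mem F hF G hG) x
  · refine h.supDeriv_le fun F hF => ?_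
    obtain ⟨H, hH, h1, -⟩ := h.exists_inverse G hG
    have h2 : F = (F ∘ H) ∘ G := by
      funext y
      simp [h1]
    have h3 := h.comp_mem F hF H hH
    have h4 := h.deriv_comp h3 hG x
    rw [← h2] at h4
    rw [h4]
    exact mul_le_mul_of_nonneg_right (h.deriv_le_supDeriv h3 _) (h.deriv_pos hG x).le

theorem lowerSemicontinuous_supDeriv (h : IsBoundedLiftGroup S C) :
    LowerSemicontinuous (supDeriv S) :=
  lowerSemicontinuous_ciSup h.bddAbove_deriv
    fun F => (h.continuous_deriv F.2).lowerSemicontinuous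

/-! ### The primitive and its translations -/

theorem intervalIntegrable_supDeriv (h : IsBoundedLiftGroup S C) (a b : ℝ) :
    IntervalIntegrable (supDeriv S) volume a b := by
  refine (intervalIntegrable_const (c := C)).mono_fun
    h.lowerSemicontinuous_supDeriv.measurable.aestronglyMeasurable (.of_forall fun x => ?_)
  have h1 := h.one_le_supDeriv x
  have h2 := h.supDeriv_le_bound x
  simp only
  rw [Real.norm_of_nonneg (by linarith)]
  exact h2.trans (le_abs_self C)

theorem primitive_sub (h : IsBoundedLiftGroup S C) (a b : ℝ) :
    supDerivPrimitive S b - supDerivPrimitive S a = ∫ t in a..b, supDeriv S t :=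
  intervalIntegral.integral_interval_sub_left (h.intervalIntegrable_supDeriv _ _)
    (h.intervalIntegrable_supDeriv _ _)

theorem strictMono_primitive (h : IsBoundedLiftGroup S C) : StrictMono (supDerivPrimitive S) := by
  intro a b hab
  have h1 : ∫ _ in a..b, (1 : ℝ) ≤ ∫ t in a..b, supDeriv S t :=
    intervalIntegral.integral_mono_on hab.le intervalIntegrable_const
      (h.intervalIntegrable_supDeriv _ _) fun x _ => h.one_le_supDeriv x
  rw [← h.primitive_sub, intervalIntegral.integral_const, smul_eq_mul, mul_one] at h1
  linarith

theorem surjective (h : IsBoundedLiftGroup S C) {F : ℝ → ℝ} (hF : F ∈ S) :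
    Function.Surjective F := by
  obtain ⟨G, -, -, h1⟩ := h.exists_inverse F hF
  exact fun y => ⟨G y, h1 y⟩

/-- Change of variables: the Jacobian of `F` is absorbed by the invariance of the density.
Continuity of the density is not needed. -/
theorem integral_supDeriv_map (h : IsBoundedLiftGroup S C) {F : ℝ → ℝ} (hF : F ∈ S) {a b : ℝ}
    (hab : a ≤ b) : ∫ t in F a..F b, supDeriv S t = ∫ t in a..b, supDeriv S t := by
  have hm := h.strictMono F hF
  have him : F '' Ioc a b = Ioc (F a) (F b) := by
    ext y
    obtain ⟨x, rfl⟩ := h.surjective hF y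
    simp [hm.injective.mem_set_image, hm.lt_iff_lt, hm.le_iff_le]
  rw [intervalIntegral.integral_of_le (hm.monotone hab), intervalIntegral.integral_of_le hab, ← him,
    integral_image_eq_integral_abs_deriv_smul measurableSet_Ioc
      (fun x _ => (h.hasDerivAt hF x).hasDerivWithinAt) hm.injective.injOn]
  refine setIntegral_congr_fun measurableSet_Ioc fun x _ => ?_
  simp only [smul_eq_mul]
  rw [abs_of_pos (h.deriv_pos hF x), mul_comm, h.supDeriv_comp_mul_deriv hF]

theorem primitive_map (h : IsBoundedLiftGroup S C) {F : ℝ → ℝ} (hF : F ∈ S) (x : ℝ) :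
    supDerivPrimitive S (F x) = supDerivPrimitive S x + supDerivPrimitive S (F 0) := by
  have h0 : supDerivPrimitive S 0 = 0 := intervalIntegral.integral_same
  rcases le_total 0 x with hx | hx
  · have := h.integral_supDeriv_map hF hx
    rw [← h.primitive_sub, ← h.primitive_sub] at this
    linarith
  · have := h.integral_supDeriv_map hF hx
    rw [← h.primitive_sub, ← h.primitive_sub] at this
    linarith

/-- The group of translations to which `supDerivPrimitive S` conjugates `S`. -/
noncomputable def translations (h : IsBoundedLiftGroup S C) : AddSubgroup ℝ where
  carrier := {t | ∃ F ∈ S, supDerivPrimitive S (F 0) = t}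
  zero_mem' := ⟨id, h.id_mem, intervalIntegral.integral_same⟩
  add_mem' := by
    rintro _ _ ⟨F, hF, rfl⟩ ⟨G, hG, rfl⟩
    exact ⟨G ∘ F, h.comp_mem G hG F hF, h.primitive_map hG (F 0)⟩
  neg_mem' := by
    rintro _ ⟨F, hF, rfl⟩
    obtain ⟨G, hG, h1, -⟩ := h.exists_inverse F hF
    refine ⟨G, hG, ?_⟩
    have h2 := h.primitive_map hG (F 0)
    rw [h1, show supDerivPrimitive S 0 = 0 from intervalIntegral.integral_same] at h2
    linarith

theorem mem_translations (h : IsBoundedLiftGroup S C) {t : ℝ} :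
    t ∈ h.translations ↔ ∃ F ∈ S, supDerivPrimitive S (F 0) = t := Iff.rfl

/-- If the group of translations is dense then every orbit of `S` is dense. -/
theorem exists_map_mem_of_dense (h : IsBoundedLiftGroup S C)
    (hd : Dense (h.translations : Set ℝ)) {V : Set ℝ} (hV : IsOpen V) (hne : V.Nonempty) (x : ℝ) :
    ∃ F ∈ S, F x ∈ V := by
  obtain ⟨v, hv⟩ := hne
  obtain ⟨δ, hδ, hball⟩ := Metric.isOpen_iff.1 hV v hv
  have hm := h.strictMono_primitive
  -- In the coordinate given by the primitive, `x` is to be translated into the image of the ball.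
  obtain ⟨t, ht, h1, h2⟩ := hd.exists_between
    (sub_lt_sub_right (hm (show v - δ < v + δ by linarith)) (supDerivPrimitive S x))
  obtain ⟨F, hF, rfl⟩ := ht
  have h3 := h.primitive_map hF x
  refine ⟨F, hF, hball ?_⟩
  rw [Real.ball_eq_Ioo]
  exact ⟨hm.lt_iff_lt.1 (by linarith), hm.lt_iff_lt.1 (by linarith)⟩

/-! ### Continuity of the density -/

/-- A bounded lower semicontinuous function has small oscillation on some nonempty open set. -/
theorem _root_.LowerSemicontinuous.exists_isOpen_oscillation_le {X : Type*} [TopologicalSpace X]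
    [Nonempty X] {f : X → ℝ} (hf : LowerSemicontinuous f) (h0 : ∀ x, 0 < f x) {B : ℝ}
    (hB : ∀ x, f x ≤ B) {ε : ℝ} (hε : 0 < ε) :
    ∃ V : Set X, IsOpen V ∧ V.Nonempty ∧ ∀ x ∈ V, ∀ y ∈ V, |f x - f y| ≤ ε := by
  classical
  have hex : ∃ k : ℕ, (interior {x | f x ≤ k * ε}).Nonempty := by
    obtain ⟨k, hk⟩ := exists_nat_ge (B / ε)
    refine ⟨k, ?_⟩
    have : {x | f x ≤ k * ε} = univ :=
      eq_univ_of_forall fun x => (hB x).trans ((div_le_iff₀ hε).1 hk)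
    rw [this, interior_univ]
    exact univ_nonempty
  -- For the least such `k`, the closed set {f ≤ (k - 1)ε} has empty interior, so removing it leaves
  -- a nonempty open set where (k - 1)ε < f ≤ kε.
  obtain ⟨k, hk, hmin⟩ : ∃ k : ℕ, (interior {x | f x ≤ k * ε}).Nonempty ∧
      ∀ m < k, ¬ (interior {x | f x ≤ m * ε}).Nonempty :=
    ⟨Nat.find hex, Nat.find_spec hex, fun m hm => Nat.find_min hex hm⟩
  obtain _ | k := k
  · obtain ⟨x, hx⟩ := hk
    have h1 : f x ≤ ((0 : ℕ) : ℝ) * ε := interior_subset (s := {x | f x ≤ ((0 : ℕ) : ℝ) * ε}) hx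
    rw [Nat.cast_zero, zero_mul] at h1
    exact absurd (h0 x) h1.not_gt
  · refine ⟨interior {x | f x ≤ (k + 1 : ℕ) * ε} ∩ {x | f x ≤ k * ε}ᶜ,
      isOpen_interior.inter (hf.isClosed_preimage _).isOpen_compl, ?_, ?_⟩
    · by_contra hemp
      refine hmin k k.lt_succ_self (hk.mono (interior_maximal (fun x hx => ?_) isOpen_interior))
      by_contra hx'
      exact hemp ⟨x, hx, hx'⟩
    · rintro x ⟨hx, hx'⟩ y ⟨hy, hy'⟩
      have h1 : f x ≤ (k + 1 : ℕ) * ε := interior_subset (s := {x | f x ≤ (k + 1 : ℕ) * ε}) hx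
      have h2 : f y ≤ (k + 1 : ℕ) * ε := interior_subset (s := {x | f x ≤ (k + 1 : ℕ) * ε}) hy
      simp only [mem_compl_iff, mem_ofPred_eq, not_le] at hx' hy'
      push_cast at h1 h2
      rw [abs_le]
      constructor <;> linarith

theorem continuous_supDeriv_of_dense (h : IsBoundedLiftGroup S C)
    (hd : Dense (h.translations : Set ℝ)) : Continuous (supDeriv S) := by
  have hC : 1 ≤ C := (h.one_le_supDeriv 0).trans (h.supDeriv_le_bound 0)
  have hC0 : 0 < C := by linarith
  refine continuous_iff_continuousAt.2 fun x => Metric.continuousAt_iff'.2 fun ε hε => ?_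
  obtain ⟨V, hV, hne, hosc⟩ := h.lowerSemicontinuous_supDeriv.exists_isOpen_oscillation_le
    (fun x => by linarith [h.one_le_supDeriv x]) h.supDeriv_le_bound
    -- Both factors of `supDeriv S (F y) * deriv F y` are at most `C`, so each varies the product by
    -- at most ε / 2.
    (show 0 < ε / (2 * C) by positivity)
  obtain ⟨F, hF, hFx⟩ := h.exists_map_mem_of_dense hd hV hne x
  have h1 : ∀ᶠ y in 𝓝 x, F y ∈ V :=
    (h.contDiff F hF).continuous.continuousAt.eventually (hV.mem_nhds hFx)
  have h2 := Metric.continuousAt_iff'.1 ((h.continuous_deriv hF).continuousAt (x := x))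
    (ε / (2 * C)) (by positivity)
  filter_upwards [h1, h2] with y hy1 hy2
  rw [Real.dist_eq] at hy2 ⊢
  have h3 := hosc _ hy1 _ hFx
  rw [← h.supDeriv_comp_mul_deriv hF y, ← h.supDeriv_comp_mul_deriv hF x]
  have h4 : supDeriv S (F y) * deriv F y - supDeriv S (F x) * deriv F x =
      (supDeriv S (F y) - supDeriv S (F x)) * deriv F y +
        supDeriv S (F x) * (deriv F y - deriv F x) := by ring
  have h5 : |(supDeriv S (F y) - supDeriv S (F x)) * deriv F y| ≤ ε / (2 * C) * C := by
    rw [abs_mul, abs_of_pos (h.deriv_pos hF y)]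
    exact mul_le_mul h3 (h.deriv_le F hF y) (h.deriv_pos hF y).le (by positivity)
  have h6 : |supDeriv S (F x) * (deriv F y - deriv F x)| < C * (ε / (2 * C)) := by
    have h7 := h.one_le_supDeriv (F x)
    rw [abs_mul, abs_of_pos (by linarith)]
    exact mul_lt_mul' (h.supDeriv_le_bound _) hy2 (abs_nonneg _) hC0
  have h8 : ε / (2 * C) * C + C * (ε / (2 * C)) = ε := by
    field_simp
    ring
  rw [h4]
  exact (abs_add_le _ _).trans_lt (by linarith)

theorem primitive_add_int (h : IsBoundedLiftGroup S C) (x : ℝ) (j : ℤ) :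
    supDerivPrimitive S (x + j) = supDerivPrimitive S x + j * supDerivPrimitive S 1 := by
  have h1 (x : ℝ) : supDerivPrimitive S (x + 1) = supDerivPrimitive S x + supDerivPrimitive S 1 := by
    simpa using h.primitive_map h.add_one_mem x
  induction j with
  | zero => simp
  | succ n ih =>
    push_cast at ih ⊢
    rw [← add_assoc, h1, ih]
    ring
  | pred n ih =>
    have h2 := h1 (x + (-(n : ℤ) - 1 : ℤ))
    push_cast at ih h2 ⊢
    rw [show x + (-(n : ℝ) - 1) + 1 = x + -n by ring, ih] at h2
    linarith

theorem primitive_one_pos (h : IsBoundedLiftGroup S C) : 0 < supDerivPrimitive S 1 := by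
  have := h.strictMono_primitive one_pos
  rwa [show supDerivPrimitive S 0 = 0 from intervalIntegral.integral_same] at this

theorem deriv_eq_of_primitive_eq (h : IsBoundedLiftGroup S C) {F G : ℝ → ℝ} (hF : F ∈ S)
    (hG : G ∈ S) (j : ℤ)
    (hj : supDerivPrimitive S (F 0) = supDerivPrimitive S (G 0) + j * supDerivPrimitive S 1) :
    deriv F = deriv G := by
  have h1 : F = fun x => G x + j := by
    funext x
    apply h.strictMono_primitive.injective
    rw [h.primitive_add_int, h.primitive_map hF, h.primitive_map hG, hj]
    ring
  funext x
  rw [h1, deriv_add_const]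

/-- The unit translation corresponds to `n * a` with `n ≠ 0`. Derivatives ignore integer
translations, so only the residues modulo `n` matter. -/
theorem continuous_supDeriv_of_cyclic (h : IsBoundedLiftGroup S C) {a : ℝ}
    (ha : h.translations = AddSubgroup.closure {a}) : Continuous (supDeriv S) := by
  have hmem (t : ℝ) : (∃ F ∈ S, supDerivPrimitive S (F 0) = t) ↔ ∃ k : ℤ, k * a = t := by
    rw [← h.mem_translations, ha, AddSubgroup.mem_closure_singleton]
    simp
  choose H hHS hH using fun r : ℤ => (hmem (r * a)).2 ⟨r, rfl⟩
  obtain ⟨n, hn⟩ := (hmem (supDerivPrimitive S 1)).1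
    ⟨fun x => x + 1, h.add_one_mem, by simp⟩
  have hn0 : n ≠ 0 := by
    rintro rfl
    have := h.primitive_one_pos
    simp at hn
    linarith
  have hfin (F : ℝ → ℝ) (hF : F ∈ S) : ∃ r ∈ Finset.Ico 0 |n|, deriv F = deriv (H r) := by
    obtain ⟨k, hk⟩ := (hmem _).1 ⟨F, hF, rfl⟩
    refine ⟨k % n, Finset.mem_Ico.2 ⟨Int.emod_nonneg _ hn0, Int.emod_lt_abs _ hn0⟩,
      h.deriv_eq_of_primitive_eq hF (hHS _) (k / n) ?_⟩
    rw [← hk, hH, ← hn]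
    have : (k : ℝ) = (k % n : ℤ) + n * (k / n : ℤ) := by
      exact_mod_cast (Int.emod_add_mul_ediv k n).symm
    linear_combination a * this
  have hne : (Finset.Ico 0 |n|).Nonempty := ⟨0, Finset.mem_Ico.2 ⟨le_rfl, abs_pos.2 hn0⟩⟩
  have heq : supDeriv S = fun x => (Finset.Ico 0 |n|).sup' hne fun r => deriv (H r) x := by
    funext x
    apply le_antisymm
    · refine h.supDeriv_le fun F hF => ?_
      obtain ⟨r, hr, hFr⟩ := hfin F hF
      rw [hFr]
      exact Finset.le_sup' (fun r => deriv (H r) x) hr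
    · exact Finset.sup'_le hne _ fun r _ => h.deriv_le_supDeriv (hHS r) x
  rw [heq]
  exact Continuous.finset_sup'_apply hne fun r _ => h.continuous_deriv (hHS r)

theorem continuous_supDeriv (h : IsBoundedLiftGroup S C) : Continuous (supDeriv S) := by
  rcases h.translations.dense_or_cyclic with hd | ⟨a, ha⟩
  · exact h.continuous_supDeriv_of_dense hd
  · exact h.continuous_supDeriv_of_cyclic ha

/-- The group `S` is conjugate to a group of translations by a `C^1` diffeomorphism commuting with
the unit translation. -/
theorem exists_conjugacy (h : IsBoundedLiftGroup S C) :
    ∃ Φ Ψ : ℝ → ℝ, ContDiff ℝ 1 Φ ∧ ContDiff ℝ 1 Ψ ∧ StrictMono Φ ∧ (∀ x, Ψ (Φ x) = x) ∧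
      (∀ x, Φ (Ψ x) = x) ∧ (∀ x, Φ (x + 1) = Φ x + 1) ∧
      ∀ F ∈ S, ∃ c, ∀ x, Φ (F x) = Φ x + c := by
  have hL := h.primitive_one_pos
  set L := supDerivPrimitive S 1 with hLdef
  -- Dividing by `L` makes the conjugacy commute with the unit translation, so that it descends to
  -- the circle.
  let Φ : ℝ → ℝ := fun x => supDerivPrimitive S x / L
  have hder (x : ℝ) : HasDerivAt Φ (supDeriv S x / L) x :=
    (h.continuous_supDeriv.integral_hasStrictDerivAt 0 x).hasDerivAt.div_const L
  have hΦ : ContDiff ℝ 1 Φ := by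
    rw [contDiff_one_iff_deriv]
    refine ⟨fun x => (hder x).differentiableAt, ?_⟩
    rw [show deriv Φ = fun x => supDeriv S x / L from funext fun x => (hder x).deriv]
    exact h.continuous_supDeriv.div_const L
  have hmono : StrictMono Φ := fun a b hab => div_lt_div_of_pos_right (h.strictMono_primitive hab) hL
  have hint (x : ℝ) (j : ℤ) : Φ (x + j) = Φ x + j := by
    simp only [Φ, h.primitive_add_int, ← hLdef]
    field_simp
  have h0 : Φ 0 = 0 := by simp [Φ, supDerivPrimitive]
  have hΦint (j : ℤ) : Φ j = j := by simpa [h0] using hint 0 j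
  have hsurj : Function.Surjective Φ := by
    intro y
    have h1 : Φ ⌊y⌋ ≤ y := by
      rw [hΦint]
      exact Int.floor_le y
    have h2 : y ≤ Φ (⌊y⌋ + 1 : ℤ) := by
      rw [hΦint]
      push_cast
      exact (Int.lt_floor_add_one y).le
    exact mem_range_of_exists_le_of_exists_ge hΦ.continuous ⟨_, h1⟩ ⟨_, h2⟩
  let e : ℝ ≃ₜ ℝ := (StrictMono.orderIsoOfSurjective Φ hmono hsurj).toHomeomorph
  have he (x : ℝ) : e x = Φ x := rfl
  refine ⟨Φ, e.symm, hΦ, ?_, hmono, fun x => e.symm_apply_apply x, fun x => e.apply_symm_apply x,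
    fun x => by simpa using hint x 1, fun F hF => ⟨Φ (F 0), fun x => ?_⟩⟩
  · refine e.contDiff_symm_deriv (f' := fun x => supDeriv S x / L) (fun x => ?_) hder hΦ
    have := h.one_le_supDeriv x
    exact (div_pos (by linarith) hL).ne'
  · simp only [Φ]
    rw [h.primitive_map hF]
    ring

end IsBoundedLiftGroup

/-! ### Lifts of circle maps -/

/-- A continuous function with values in `ℤ` is constant. -/
theorem exists_eq_int_of_coe_eq_zero {u : ℝ → ℝ} (hu : Continuous u)
    (h0 : ∀ x, (u x : UnitAddCircle) = 0) : ∃ k : ℤ, ∀ x, u x = k := by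
  have h1 (x : ℝ) : ∃ k : ℤ, (k : ℝ) = u x := by
    obtain ⟨k, hk⟩ := (AddCircle.coe_eq_zero_iff (1 : ℝ)).1 (h0 x)
    exact ⟨k, by simpa using hk⟩
  choose k hk using h1
  have hc : Continuous k := by
    rw [Int.isClosedEmbedding_coe_real.isInducing.continuous_iff]
    convert hu using 1
    exact funext hk
  refine ⟨k 0, fun x => ?_⟩
  rw [← hk, PreconnectedSpace.constant inferInstance hc (x := x) (y := 0)]

theorem unitAddCircle_coe_int (k : ℤ) : ((k : ℝ) : UnitAddCircle) = 0 :=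
  (AddCircle.coe_eq_zero_iff (1 : ℝ)).2 ⟨k, by simp⟩

namespace IsCircleLift

variable {F G : ℝ → ℝ} {f g : UnitAddCircle → UnitAddCircle}

theorem exists_eq_add_int (hF : IsCircleLift F f) (hG : IsCircleLift G f) :
    ∃ k : ℤ, ∀ x, F x = G x + k := by
  obtain ⟨k, hk⟩ := exists_eq_int_of_coe_eq_zero (u := fun x => F x - G x)
    (hF.continuous.sub hG.continuous) fun x => by
    rw [AddCircle.coe_sub, hF.coe_apply, hG.coe_apply, sub_self]
  exact ⟨k, fun x => by linarith [hk x]⟩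

theorem comp (hF : IsCircleLift F f) (hG : IsCircleLift G g) : IsCircleLift (F ∘ G) (f ∘ g) where
  continuous := hF.continuous.comp hG.continuous
  coe_apply x := by simp [hF.coe_apply, hG.coe_apply]

theorem add_int (hF : IsCircleLift F f) (k : ℤ) : IsCircleLift (fun x => F x + k) f where
  continuous := hF.continuous.add_const _
  coe_apply x := by rw [AddCircle.coe_add, hF.coe_apply, unitAddCircle_coe_int, add_zero]

theorem id : IsCircleLift _root_.id _root_.id := ⟨continuous_id, fun _ => rfl⟩

/-- Every lift has a degree. -/
theorem exists_degree (hF : IsCircleLift F f) :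
    ∃ d : ℤ, ∀ (x : ℝ) (j : ℤ), F (x + j) = F x + j * d := by
  obtain ⟨d, hd⟩ := exists_eq_int_of_coe_eq_zero (u := fun x => F (x + 1) - F x)
    ((hF.continuous.comp (continuous_add_const 1)).sub hF.continuous) fun x => by
      rw [AddCircle.coe_sub, hF.coe_apply, hF.coe_apply, AddCircle.coe_add, AddCircle.coe_period,
        add_zero, sub_self]
  have h1 (x : ℝ) : F (x + 1) = F x + d := by linarith [hd x]
  refine ⟨d, fun x j => ?_⟩
  induction j with
  | zero => simp
  | succ n ih =>
    push_cast at ih ⊢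
    rw [← add_assoc, h1, ih]
    ring
  | pred n ih =>
    have h2 := h1 (x + (-(n : ℤ) - 1 : ℤ))
    push_cast at ih h2 ⊢
    rw [show x + (-(n : ℝ) - 1) + 1 = x + -n by ring, ih] at h2
    linarith

end IsCircleLift

/-- The increasing `C^1` lifts of the elements of `Γ`. -/
def circleLifts (Γ : Subgroup (Equiv.Perm UnitAddCircle)) : Set (ℝ → ℝ) :=
  {F | ContDiff ℝ 1 F ∧ StrictMono F ∧ ∃ f ∈ Γ, IsCircleLift F f}

theorem IsCircleC1Diffeo.exists_lift {f : Equiv.Perm UnitAddCircle} (hf : IsCircleC1Diffeo f) :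
    ∃ F : ℝ → ℝ, ContDiff ℝ 1 F ∧ StrictMono F ∧ IsCircleLift F f := by
  obtain ⟨F, hF, hF1⟩ := hf.c1
  obtain ⟨G, hG, hGm⟩ := hf.orientationPreserving
  obtain ⟨k, hk⟩ := hF.exists_eq_add_int hG
  refine ⟨F, hF1, fun x y hxy => ?_, hF⟩
  rw [hk, hk]
  linarith [hGm hxy]

theorem exists_inverse_lift {Γ : Subgroup (Equiv.Perm UnitAddCircle)}
    (hΓ : ∀ f ∈ Γ, IsCircleC1Diffeo f) {F : ℝ → ℝ} (hF : F ∈ circleLifts Γ) :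
    ∃ G ∈ circleLifts Γ, (∀ x, G (F x) = x) ∧ ∀ x, F (G x) = x := by
  obtain ⟨-, hFm, f, hf, hFf⟩ := hF
  obtain ⟨G, hG1, hGm, hG⟩ := (hΓ _ (Γ.inv_mem hf)).exists_lift
  have h1 := hG.comp hFf
  rw [show (⇑f⁻¹ ∘ ⇑f) = id from funext fun x => f.symm_apply_apply x] at h1
  obtain ⟨k, hk⟩ := h1.exists_eq_add_int IsCircleLift.id
  -- The shift by `-k` makes the lift of the inverse a left inverse of `F`; evaluating at `F 0` then
  -- shows that it is a right inverse too.
  have h2 := hFf.comp (hG.add_int (-k))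
  rw [show (⇑f ∘ ⇑f⁻¹) = id from funext fun x => f.apply_symm_apply x] at h2
  obtain ⟨l, hl⟩ := h2.exists_eq_add_int IsCircleLift.id
  simp only [Function.comp_apply, id_eq] at hk hl
  have h3 (x : ℝ) : G (F x) + (-k : ℤ) = x := by
    rw [hk]
    push_cast
    ring
  have hl0 : (l : ℝ) = 0 := by
    have := hl (F 0)
    rw [h3] at this
    linarith
  exact ⟨fun x => G x + (-k : ℤ), ⟨hG1.add contDiff_const, fun x y hxy =>
    by linarith [hGm hxy], f⁻¹, Γ.inv_mem hf, hG.add_int _⟩, h3, fun x => by rw [hl, hl0, add_zero]⟩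

theorem isBoundedLiftGroup_circleLifts {Γ : Subgroup (Equiv.Perm UnitAddCircle)}
    (hΓ : ∀ f ∈ Γ, IsCircleC1Diffeo f) {C : ℝ} (hC : ∀ f ∈ Γ, CircleDerivBoundedBy f C) :
    IsBoundedLiftGroup (circleLifts Γ) C where
  contDiff F hF := hF.1
  strictMono F hF := hF.2.1
  comp_mem := by
    rintro F ⟨hF1, hFm, f, hf, hFf⟩ G ⟨hG1, hGm, g, hg, hGg⟩
    exact ⟨hF1.comp hG1, hFm.comp hGm, f * g, Γ.mul_mem hf hg, hFf.comp hGg⟩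
  exists_inverse F hF := exists_inverse_lift hΓ hF
  add_one_mem := ⟨contDiff_id.add contDiff_const, fun x y hxy => by simpa using hxy, 1, Γ.one_mem,
    by simpa using IsCircleLift.id.add_int 1⟩
  map_add_one F hF x := by
    obtain ⟨G, ⟨-, -, g, -, hG⟩, h1, -⟩ := exists_inverse_lift hΓ hF
    obtain ⟨-, hFm, f, -, hFf⟩ := hF
    obtain ⟨d, hd⟩ := hFf.exists_degree
    obtain ⟨e, he⟩ := hG.exists_degree
    have h2 : F (x + 1) = F x + d := by simpa using hd x 1
    have h3 := h1 (x + 1)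
    rw [h2, he, h1] at h3
    -- The degrees of `F` and of its inverse are inverse integers; monotonicity excludes -1.
    have h4 : d * e = 1 := by
      have : (d : ℝ) * e = 1 := by linarith
      exact_mod_cast this
    have h5 : 0 < d := by
      have := hFm (lt_add_one x)
      rw [h2] at this
      exact_mod_cast (by linarith : (0 : ℝ) < d)
    rcases Int.eq_one_or_neg_one_of_mul_eq_one h4 with rfl | rfl
    · simpa using h2
    · omega
  deriv_le := by
    rintro F ⟨-, -, f, hf, hF⟩ x
    exact (le_abs_self _).trans (hC f hf F hF x)

/-- The circle map induced by a map of `ℝ` which commutes with the unit translation. -/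
noncomputable def circleMapOfLift (Φ : ℝ → ℝ) (h : ∀ x, Φ (x + 1) = Φ x + 1) :
    UnitAddCircle → UnitAddCircle :=
  Function.Periodic.lift (f := fun x => (Φ x : UnitAddCircle)) (c := (1 : ℝ)) fun x => by
    simp only
    rw [h, AddCircle.coe_add, AddCircle.coe_period, add_zero]

theorem proposition1 (Γ : Subgroup (Equiv.Perm UnitAddCircle))
    (hΓ : ∀ f ∈ Γ, IsCircleC1Diffeo f)
    (hbdd : ∃ C : ℝ, ∀ f ∈ Γ, CircleDerivBoundedBy f C) :
    ∃ φ : Equiv.Perm UnitAddCircle, IsCircleC1Diffeo φ ∧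
      ∀ f ∈ Γ, φ * f * φ⁻¹ ∈ circleRotations := by
  obtain ⟨C, hC⟩ := hbdd
  obtain ⟨Φ, Ψ, hΦ1, hΨ1, hΦm, hΨΦ, hΦΨ, hΦ, hconj⟩ :=
    (isBoundedLiftGroup_circleLifts hΓ hC).exists_conjugacy
  have hΨ (x : ℝ) : Ψ (x + 1) = Ψ x + 1 := by
    rw [← hΨΦ (Ψ x + 1), hΦ, hΦΨ]
  let φ : Equiv.Perm UnitAddCircle :=
    { toFun := circleMapOfLift Φ hΦ
      invFun := circleMapOfLift Ψ hΨ
      left_inv := fun x => by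
        induction x using QuotientAddGroup.induction_on with
        | H x => exact congrArg _ (hΨΦ x)
      right_inv := fun x => by
        induction x using QuotientAddGroup.induction_on with
        | H x => exact congrArg _ (hΦΨ x) }
  have hφ : IsCircleLift Φ φ := ⟨hΦ1.continuous, fun _ => rfl⟩
  have hφ' : IsCircleLift Ψ φ.symm := ⟨hΨ1.continuous, fun _ => rfl⟩
  refine ⟨φ, ⟨⟨Φ, hφ, hΦ1⟩, ⟨Ψ, hφ', hΨ1⟩, ⟨Φ, hφ, hΦm⟩⟩, fun f hf => ?_⟩
  obtain ⟨F, hF1, hFm, hF⟩ := (hΓ f hf).exists_lift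
  obtain ⟨c, hc⟩ := hconj F ⟨hF1, hFm, f, hf, hF⟩
  refine ⟨c, fun x => ?_⟩
  induction x using QuotientAddGroup.induction_on with
  | H y =>
    have h1 := ((hφ.comp hF).comp hφ').coe_apply y
    simp only [Function.comp_apply, hc, hΦΨ, AddCircle.coe_add] at h1
    exact h1.symm
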